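/- Conventions. Let $p$ be a prime and $R$ a Noetherian commutative ring of characteristic $p$. Let $R^{\circ}$ be the set of elements of $R$ that lie in no minimal prime ideal. For $e\ge 0$ let ${}^eR$ be the ring $R$ viewed as an $R$-algebra via the iterated Frobenius $F^e\colon x\mapsto x^{p^e}$; $R$ is F-finite if ${}^1R$ is a finitely generated $R$-module. For an $R$-module $M$ and $z\in M$, put $q=p^e$ and let $z^q$ be the image $z\otimes 1$ of $z$ in $M\otimes_R{}^eR$, regarded as an $R$-module through the right factor. For ideals $\mathfrak a_1,\dots,\mathfrak a_r\subseteq R$ and real numbers $t_1,\dots,t_r\ge 0$, let $0_M^{*\mathfrak a_1^{t_1}\cdots\mathfrak a_r^{t_r}}$ be the submodule of all $z\in M$ for which there is $c\in R^{\circ}$ with $$c\,z^q\,\mathfrak a_1^{\lceil t_1q\rceil}\cdots\mathfrak a_r^{\lceil t_rq\rceil}=0\quad\text{in } M\otimes_R{}^eR\quad\text{for all large } q=p^e$$ (where $\mathfrak a_i^{0}=R$). Let $E=\bigoplus_{\mathfrak m}E_R(R/\mathfrak m)$ be the direct sum, over all maximal ideals $\mathfrak m$ of $R$, of the injective hulls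 of the residue fields, and put $$\widetilde\tau(\mathfrak a_1^{t_1}\cdots\mathfrak a_r^{t_r})=\operatorname{Ann}_R\bigl(0_E^{*\mathfrak a_1^{t_1}\cdots\mathfrak a_r^{t_r}}\bigr).$$ Theorem. Let $R$ be an F-finite reduced Noetherian ring of prime characteristic $p>0$, and let $\mathfrak a,\mathfrak b\subseteq R$ be ideals such that $\mathfrak a\cap R^{\circ}\neq\emptyset$ and $\mathfrak b\cap R^{\circ}\neq\emptyset$. Then for every real number $t>0$, $$\widetilde\tau\bigl((\mathfrak a+\mathfrak b)^t\bigr)=\sum_{\substack{\lambda,\mu\ge 0\\ \lambda+\mu=t}}\widetilde\tau\bigl(\mathfrak a^{\lambda}\mathfrak b^{\mu}\bigr),$$ where $\lambda,\mu$ range over all non-negative real numbers with $\lambda+\mu=t$. -/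

import Mathlib

open scoped TensorProduct DirectSum

universe u

noncomputable section

/-! ### Injective hulls -/

/-- `i : M → E` is an injective hull of `M`: an essential embedding into an injective module. -/
structure IsInjectiveHull (R : Type u) [CommRing R] {M E : Type u} [AddCommGroup M] [Module R M]
    [AddCommGroup E] [Module R E] (i : M →ₗ[R] E) : Prop where
  injective_map : Function.Injective i
  essential : ∀ K : Submodule R E, K ⊓ LinearMap.range i = ⊥ → K = ⊥
  injective_module : Module.Injective R E

theorem exists_isInjectiveHull (R : Type u) [CommRing R] (M : Type u) [AddCommGroup M]
    [Module R M] :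
    ∃ E : ModuleCat.{u} R, ∃ i : M →ₗ[R] E, IsInjectiveHull R i := by
  obtain ⟨⟨I, hI, f, hf⟩⟩ :=
    (ModuleCat.enoughInjectives.{u, u} (R := R)).presentation (ModuleCat.of R M)
  have hfi : Function.Injective f.hom := (ModuleCat.mono_iff_injective f).1 hf
  have hInj : Module.Injective R I :=
    (Module.injective_iff_injective_object R I).2 hI
  set A : Submodule R I := LinearMap.range f.hom with hA
  -- a maximal essential extension of `A` inside `I`
  obtain ⟨N, hAN, hN⟩ := zorn_le_nonempty₀
    {N : Submodule R I | A ≤ N ∧ ∀ K : Submodule R I, K ≤ N → K ⊓ A = ⊥ → K = ⊥}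
    (by
      intro c hc hchain y hy
      refine ⟨sSup c, ⟨(hc hy).1.trans (le_sSup hy), ?_⟩, fun z hz => le_sSup hz⟩
      intro K hK hKA
      rw [Submodule.eq_bot_iff]
      intro x hx
      obtain ⟨N, hNc, hxN⟩ :=
        (Submodule.mem_sSup_of_directed ⟨y, hy⟩ hchain.directedOn).1 (hK hx)
      have h1 : Submodule.span R {x} = ⊥ := by
        refine (hc hNc).2 _ ((Submodule.span_singleton_le_iff_mem _ _).2 hxN) ?_
        refine le_bot_iff.1 (le_trans (inf_le_inf_right A ?_) hKA.le)
        exact (Submodule.span_singleton_le_iff_mem _ _).2 hx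
      exact Submodule.span_singleton_eq_bot.1 h1)
    A ⟨le_rfl, fun K hK hKA => by rwa [inf_eq_left.2 hK] at hKA⟩
  -- a maximal submodule disjoint from `N`
  obtain ⟨K, -, hK⟩ := zorn_le_nonempty₀ {K : Submodule R I | K ⊓ N = ⊥}
    (by
      intro c hc hchain y hy
      refine ⟨sSup c, ?_, fun z hz => le_sSup hz⟩
      change sSup c ⊓ N = ⊥
      rw [Submodule.eq_bot_iff]
      rintro x ⟨hx, hxN⟩
      obtain ⟨L, hLc, hxL⟩ := (Submodule.mem_sSup_of_directed ⟨y, hy⟩ hchain.directedOn).1 hx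
      have h1 : L ⊓ N = ⊥ := hc hLc
      exact (Submodule.eq_bot_iff _).1 h1 x ⟨hxL, hxN⟩)
    ⊥ (by simp)
  have hKN : K ⊓ N = ⊥ := hK.prop
  let j : N →ₗ[R] (I ⧸ K) := K.mkQ ∘ₗ N.subtype
  have hj : Function.Injective j := by
    rw [← LinearMap.ker_eq_bot, Submodule.eq_bot_iff]
    intro n hn
    have h1 : (n : I) ∈ K := (Submodule.Quotient.mk_eq_zero K).1 hn
    exact Subtype.ext ((Submodule.eq_bot_iff _).1 hKN n ⟨h1, n.2⟩)
  have hess : ∀ L : Submodule R (I ⧸ K), L ⊓ LinearMap.range j = ⊥ → L = ⊥ := by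
    intro L hL
    have hKL : K ≤ L.comap K.mkQ := by
      intro x hx
      have h0 : K.mkQ x = 0 := (Submodule.Quotient.mk_eq_zero K).2 hx
      rw [Submodule.mem_comap, h0]
      exact L.zero_mem
    have h1 : L.comap K.mkQ ⊓ N = ⊥ := by
      rw [Submodule.eq_bot_iff]
      rintro x ⟨hxL, hxN⟩
      have h2 : K.mkQ x = 0 := (Submodule.eq_bot_iff _).1 hL _ ⟨hxL, ⟨⟨x, hxN⟩, rfl⟩⟩
      exact (Submodule.eq_bot_iff _).1 hKN x ⟨(Submodule.Quotient.mk_eq_zero K).1 h2, hxN⟩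
    have h3 : L.comap K.mkQ ≤ K := hK.le_of_ge h1 hKL
    rw [Submodule.eq_bot_iff]
    intro x hx
    obtain ⟨x, rfl⟩ := K.mkQ_surjective x
    exact (Submodule.Quotient.mk_eq_zero K).2 (h3 hx)
  obtain ⟨g, hg⟩ := hInj.out j hj N.subtype
  have hgker : LinearMap.ker g = ⊥ := by
    apply hess
    rw [Submodule.eq_bot_iff]
    rintro _ ⟨hx, ⟨n, rfl⟩⟩
    have h1 : (n : I) = 0 := by
      have h2 := hg n
      rw [LinearMap.mem_ker.1 hx] at h2
      exact h2.symm
    rw [show n = 0 from Subtype.ext h1, map_zero]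
  have hNg : N ≤ LinearMap.range g := fun n hn => ⟨j ⟨n, hn⟩, hg ⟨n, hn⟩⟩
  have hgN : LinearMap.range g ≤ N := by
    refine hN.le_of_ge ⟨hAN.trans hNg, ?_⟩ hNg
    intro T hT hTA
    have hTN : T ⊓ N = ⊥ := by
      apply hN.prop.2 _ inf_le_right
      exact le_bot_iff.1 (le_trans (inf_le_inf_right A inf_le_left) hTA.le)
    have h1 : T.comap g = ⊥ := by
      apply hess
      rw [Submodule.eq_bot_iff]
      rintro _ ⟨hx, ⟨n, rfl⟩⟩
      have h2 : g (j n) = n := hg n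
      have h3 : (n : I) ∈ T := h2 ▸ hx
      have h4 : (n : I) = 0 := (Submodule.eq_bot_iff _).1 hTN _ ⟨h3, n.2⟩
      rw [show n = 0 from Subtype.ext h4, map_zero]
    rw [Submodule.eq_bot_iff]
    intro x hx
    obtain ⟨y, rfl⟩ := hT hx
    rw [(Submodule.eq_bot_iff _).1 h1 y hx, map_zero]
  let π : I →ₗ[R] N := (g ∘ₗ K.mkQ).codRestrict N (fun x => hgN ⟨_, rfl⟩)
  have hπ : ∀ n : N, π n = n := fun n => Subtype.ext (hg n)
  refine ⟨ModuleCat.of R N, f.hom.codRestrict N (fun x => hAN ⟨x, rfl⟩), ?_, ?_, ?_⟩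
  · intro x y hxy
    exact hfi (congrArg Subtype.val hxy)
  · intro L hL
    have h1 : L.map N.subtype = ⊥ := by
      apply hN.prop.2 _ (Submodule.map_subtype_le N L)
      rw [Submodule.eq_bot_iff]
      rintro _ ⟨⟨n, hn, rfl⟩, ⟨m, hm⟩⟩
      have h2 : n = 0 := (Submodule.eq_bot_iff _).1 hL n ⟨hn, ⟨m, Subtype.ext hm⟩⟩
      rw [h2, map_zero]
    rw [Submodule.eq_bot_iff]
    intro n hn
    exact Subtype.ext ((Submodule.eq_bot_iff _).1 h1 n ⟨n, hn, rfl⟩)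
  · refine ⟨fun X Y _ _ _ _ a ha b => ?_⟩
    obtain ⟨h, hh⟩ := hInj.out a ha (N.subtype ∘ₗ b)
    exact ⟨π ∘ₗ h, fun x => by
      rw [LinearMap.comp_apply, hh x]
      exact hπ (b x)⟩

/-- The injective hull `E_R(M)` of an `R`-module `M`. -/
def InjectiveHull (R : Type u) [CommRing R] (M : Type u) [AddCommGroup M] [Module R M] : Type u :=
  (exists_isInjectiveHull R M).choose

instance (R : Type u) [CommRing R] (M : Type u) [AddCommGroup M] [Module R M] :
    AddCommGroup (InjectiveHull R M) :=
  inferInstanceAs (AddCommGroup (exists_isInjectiveHull R M).choose)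

instance (R : Type u) [CommRing R] (M : Type u) [AddCommGroup M] [Module R M] :
    Module R (InjectiveHull R M) :=
  inferInstanceAs (Module R (exists_isInjectiveHull R M).choose)

/-- The embedding `M → E_R(M)`. -/
def InjectiveHull.ι (R : Type u) [CommRing R] (M : Type u) [AddCommGroup M] [Module R M] :
    M →ₗ[R] InjectiveHull R M :=
  (exists_isInjectiveHull R M).choose_spec.choose

theorem InjectiveHull.isInjectiveHull (R : Type u) [CommRing R] (M : Type u) [AddCommGroup M]
    [Module R M] : IsInjectiveHull R (InjectiveHull.ι R M) :=
  (exists_isInjectiveHull R M).choose_spec.choose_spec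

/-- `E = ⨁ E_R(R/m)`, the direct sum over all maximal ideals `m` of `R`. -/
abbrev ResidueHull (R : Type u) [CommRing R] : Type u :=
  ⨁ m : MaximalSpectrum R, InjectiveHull R (R ⧸ m.asIdeal)

/-! ### Frobenius -/

/-- `R` is F-finite: `R` is a finite module over itself via the Frobenius map `x ↦ x ^ p`. -/
def IsFFinite (R : Type u) [CommRing R] (p : ℕ) [Fact p.Prime] [CharP R p] : Prop :=
  (frobenius R p).Finite

/-- The ring `ᵉR`: a copy of `R`, which is made an `R`-algebra through the `e`-fold iterated
Frobenius map `R → R`, `x ↦ x ^ (p ^ e)`. -/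
def FrobTwist (R : Type u) [CommRing R] (_p _e : ℕ) : Type u := R

instance (R : Type u) [CommRing R] (p e : ℕ) : CommRing (FrobTwist R p e) :=
  inferInstanceAs (CommRing R)

/-- The identity `R → ᵉR` on underlying rings (it is not `R`-linear). -/
def toFrobTwist (R : Type u) [CommRing R] (p e : ℕ) : R ≃+* FrobTwist R p e := RingEquiv.refl R

instance (R : Type u) [CommRing R] (p e : ℕ) [Fact p.Prime] [CharP R p] :
    Algebra R (FrobTwist R p e) :=
  ((toFrobTwist R p e).toRingHom.comp (iterateFrobenius R p e)).toAlgebra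

theorem algebraMap_frobTwist (R : Type u) [CommRing R] (p e : ℕ) [Fact p.Prime] [CharP R p]
    (x : R) : algebraMap R (FrobTwist R p e) x = toFrobTwist R p e (x ^ p ^ e) := rfl

/-- The Frobenius functor `𝔽ᵉ(M) = ᵉR ⊗ M`, a module over the ring `ᵉR` (which is `R`). -/
abbrev FrobModule (R : Type u) [CommRing R] (p e : ℕ) [Fact p.Prime] [CharP R p]
    (M : Type u) [AddCommGroup M] [Module R M] : Type u :=
  FrobTwist R p e ⊗[R] M

/-- The element `z ^ q = 1 ⊗ z` of `𝔽ᵉ(M)`, where `q = p ^ e`. -/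
def frobPow {R : Type u} [CommRing R] (p e : ℕ) [Fact p.Prime] [CharP R p]
    {M : Type u} [AddCommGroup M] [Module R M] (z : M) : FrobModule R p e M :=
  (1 : FrobTwist R p e) ⊗ₜ[R] z

/-- `N^[q]`, the image of `𝔽ᵉ(N) → 𝔽ᵉ(M)`. -/
def frobImage {R : Type u} [CommRing R] (p e : ℕ) [Fact p.Prime] [CharP R p]
    {M : Type u} [AddCommGroup M] [Module R M] (N : Submodule R M) :
    Submodule (FrobTwist R p e) (FrobModule R p e M) :=
  LinearMap.range (N.subtype.baseChange (FrobTwist R p e))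

/-! ### Tight closure with real exponents and the ideal `τ̃` -/

/-- `R°`, the elements of `R` that lie in no minimal prime ideal. -/
def ringCirc (R : Type u) [CommRing R] : Submonoid R where
  carrier := {c | ∀ P ∈ minimalPrimes R, c ∉ P}
  one_mem' P hP h := hP.1.1.ne_top ((Ideal.eq_top_iff_one P).2 h)
  mul_mem' ha hb P hP h := (hP.1.1.mem_or_mem h).elim (ha P hP) (hb P hP)

/-- The ideal `𝔞₁ ^ ⌈t₁ q⌉ ⋯ 𝔞ᵣ ^ ⌈tᵣ q⌉`, where `q = p ^ e`. -/
def ceilPow {R : Type u} [CommRing R] (p : ℕ) {r : ℕ} (𝔞 : Fin r → Ideal R) (t : Fin r → ℝ)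
    (e : ℕ) : Ideal R :=
  ∏ i, 𝔞 i ^ ⌈t i * (p : ℝ) ^ e⌉₊

/-- The `𝔞₁ ^ t₁ ⋯ 𝔞ᵣ ^ tᵣ`-tight closure of a submodule `N` of `M` (for exponents `tᵢ ≥ 0`): all
`z` for which there is `c ∈ R°` with `c z ^ q 𝔞₁ ^ ⌈t₁ q⌉ ⋯ 𝔞ᵣ ^ ⌈tᵣ q⌉ ⊆ N^[q]` for all
large `q = p ^ e`. -/
def tightClosure {R : Type u} [CommRing R] (p : ℕ) [Fact p.Prime] [CharP R p]
    {r : ℕ} (𝔞 : Fin r → Ideal R) (t : Fin r → ℝ)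
    {M : Type u} [AddCommGroup M] [Module R M] (N : Submodule R M) : Submodule R M where
  carrier := {z | ∃ c ∈ ringCirc R, ∃ e₀ : ℕ, ∀ e ≥ e₀, ∀ x ∈ ceilPow p 𝔞 t e,
    toFrobTwist R p e (c * x) • frobPow p e z ∈ frobImage p e N}
  zero_mem' := ⟨1, one_mem _, 0, fun e _ x _ => by simp [frobPow]⟩
  add_mem' := by
    rintro y z ⟨c, hc, e₁, h₁⟩ ⟨d, hd, e₂, h₂⟩
    refine ⟨c * d, mul_mem hc hd, max e₁ e₂, fun e he x hx => ?_⟩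
    have hy := h₁ e (le_of_max_le_left he) x hx
    have hz := h₂ e (le_of_max_le_right he) x hx
    have e1 : toFrobTwist R p e (c * d * x) =
        toFrobTwist R p e d * toFrobTwist R p e (c * x) := by
      rw [← map_mul]; congr 1; ring
    have e2 : toFrobTwist R p e (c * d * x) =
        toFrobTwist R p e c * toFrobTwist R p e (d * x) := by
      rw [← map_mul]; congr 1; ring
    have e3 : frobPow p e (y + z) = frobPow (R := R) p e y + frobPow p e z :=
      TensorProduct.tmul_add _ _ _
    rw [e3, smul_add]
    refine add_mem ?_ ?_
    · rw [e1, mul_smul]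
      exact Submodule.smul_mem _ _ hy
    · rw [e2, mul_smul]
      exact Submodule.smul_mem _ _ hz
  smul_mem' := by
    rintro a z ⟨c, hc, e₀, h⟩
    refine ⟨c, hc, e₀, fun e he x hx => ?_⟩
    have e1 : frobPow p e (a • z) =
        algebraMap R (FrobTwist R p e) a • frobPow (R := R) p e z := by
      rw [algebraMap_smul]
      exact TensorProduct.tmul_smul _ _ _
    rw [e1, smul_comm]
    exact Submodule.smul_mem _ _ (h e he x hx)

/-- The ideal `τ̃(𝔞₁ ^ t₁ ⋯ 𝔞ᵣ ^ tᵣ)`: the annihilator of the `𝔞₁ ^ t₁ ⋯ 𝔞ᵣ ^ tᵣ`-tight closure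
of zero in `E = ⨁ E_R(R/m)`. -/
def tauTilde {R : Type u} [CommRing R] (p : ℕ) [Fact p.Prime] [CharP R p]
    {r : ℕ} (𝔞 : Fin r → Ideal R) (t : Fin r → ℝ) : Ideal R :=
  (tightClosure p 𝔞 t (⊥ : Submodule R (ResidueHull R))).annihilator

end

/-!
For `q = p ^ e` let `I_e(𝔟)` be the ideal generated by the images of an ideal `𝔟` under all
`p⁻ᵉ`-linear maps on `R`. The heart of the matter is the formula
`τ̃(𝔞₁ ^ t₁ ⋯ 𝔞ᵣ ^ tᵣ) = ∑ₑ I_e(D 𝔞₁ ^ ⌈t₁ q⌉ ⋯ 𝔞ᵣ ^ ⌈tᵣ q⌉)`, where `D ∈ R°` depends on `R` only.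
Since `I_e` commutes with sums of ideals, the theorem reduces to the identity
`(𝔞 + 𝔟) ^ ⌈t q⌉ = ∑ 𝔞 ^ ⌈λ q⌉ 𝔟 ^ ⌈μ q⌉`, where `λ + μ = t`.

For the formula, `E` being a direct sum of injectives implies that `y ⊗ z = 0` in `ᵉR ⊗ E` if and
only if `z` is killed by `I_e(y)`, so that `0_E^*` is described by the ideals `I_e`; and `E` being a
cogenerator gives `Ann_R (Ann_E J) = J`.

The element `D` exists because `F_*R` is projective after inverting some `d ∈ R°`. Then
`c ∈ I_e(c)^[q]` over `R_d` for all `e`, so if `c` is a nonzerodivisor, Krull's intersection theorem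
prevents all the `I_e(c)` from lying in one prime ideal of `R_d`: some power of `d` lies in some
`I_e(c)`. Applying a further Cartier map lowers this power to `d ^ 3`.
-/

universe v

section OrderIdeal

variable {R : Type u} [CommRing R] {M : Type*} [AddCommGroup M] [Module R M]

variable (R) in
/-- The order ideal of an element `y` of `M`: all values `φ y` of linear forms `φ` on `M`. -/
def orderIdeal (y : M) : Ideal R :=
  LinearMap.range (Module.Dual.eval R M y)

theorem exists_comp_eq_of_ker_le {A B : Type*} {E : Type v} [AddCommGroup A] [Module R A]
    [AddCommGroup B] [Module R B] [AddCommGroup E] [Module R E] [Small.{v} R]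
    [Module.Injective R E]
    (f : A →ₗ[R] B) (g : A →ₗ[R] E) (h : LinearMap.ker f ≤ LinearMap.ker g) :
    ∃ k : B →ₗ[R] E, k ∘ₗ f = g := by
  obtain ⟨k, hk⟩ := Module.Injective.extension_property R E _ _
    ((LinearMap.ker f).liftQ f le_rfl)
    (LinearMap.ker_eq_bot.1 (Submodule.ker_liftQ_eq_bot _ _ _ le_rfl))
    ((LinearMap.ker f).liftQ g h)
  exact ⟨k, by rw [← (LinearMap.ker f).liftQ_mkQ f le_rfl, ← LinearMap.comp_assoc, hk,
    Submodule.liftQ_mkQ]⟩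

theorem mem_torsionBySet_orderIdeal {N : Type*} [AddCommGroup N] [Module R N] {y : M} {z : N} :
    z ∈ Submodule.torsionBySet R N (orderIdeal R y) ↔ ∀ φ : Module.Dual R M, φ y • z = 0 := by
  rw [Submodule.mem_torsionBySet_iff]
  exact ⟨fun h φ => h ⟨φ y, φ, rfl⟩, fun h => by rintro ⟨_, φ, rfl⟩; exact h φ⟩

theorem mem_torsionBySet_orderIdeal_of_tmul_eq_zero {N : Type*} [AddCommGroup N] [Module R N]
    {y : M} {z : N} (h : y ⊗ₜ[R] z = 0) : z ∈ Submodule.torsionBySet R N (orderIdeal R y) :=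
  mem_torsionBySet_orderIdeal.2 fun φ => by
    simpa using congrArg (TensorProduct.lid R N ∘ φ.rTensor N) h

theorem tmul_eq_zero_of_mem_torsionBySet_orderIdeal {E : Type v} [AddCommGroup E] [Module R E]
    [Small.{v} R] [Module.Injective R E] [Module.FinitePresentation R M] {y : M} {z : E}
    (h : z ∈ Submodule.torsionBySet R E (orderIdeal R y)) : y ⊗ₜ[R] z = 0 := by
  obtain ⟨n, m, π, B, hπ, hB⟩ := Module.FinitePresentation.exists_fin' R M
  obtain ⟨v, rfl⟩ := hπ y
  -- `f ↦ f v • z` kills the forms vanishing on the relations, so it factors through `f ↦ f ∘ B`.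
  obtain ⟨k, hk⟩ : ∃ k : Module.Dual R (Fin m → R) →ₗ[R] E,
      k ∘ₗ B.dualMap = LinearMap.toSpanSingleton R E z ∘ₗ Module.Dual.eval R _ v := by
    refine exists_comp_eq_of_ker_le _ _ fun f hf => ?_
    obtain ⟨φ, rfl⟩ := (LinearMap.exact_lcomp_of_exact_of_surjective R hB hπ f).1 hf
    exact mem_torsionBySet_orderIdeal.1 h φ
  have hcoord (i : Fin n) : v i • z = ∑ j, B (Pi.single j 1) i • k (LinearMap.proj j) := by
    have hproj : B.dualMap (LinearMap.proj i) = ∑ j, B (Pi.single j 1) i • LinearMap.proj j :=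
      LinearMap.pi_ext' fun j => LinearMap.ext_ring (by simp [Pi.single_apply])
    simpa [hproj] using (LinearMap.congr_fun hk (LinearMap.proj i)).symm
  have hvanish := TensorProduct.sum_tmul_eq_zero_of_vanishesTrivially R
    (m := fun i => π fun j => if i = j then 1 else 0) (n := fun i => v i • z)
    ⟨m, fun i j => B (Pi.single j 1) i, fun j => k (LinearMap.proj j), hcoord,
      fun j => (π.pi_apply_eq_sum_univ _).symm.trans (hB.apply_apply_eq_zero _)⟩
  rw [π.pi_apply_eq_sum_univ v, TensorProduct.sum_tmul]
  simpa only [TensorProduct.smul_tmul] using hvanish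

theorem tmul_eq_zero_of_forall_directSum {ι : Type*} {N : ι → Type*} [∀ i, AddCommGroup (N i)]
    [∀ i, Module R (N i)] {y : M} {z : ⨁ i, N i} (h : ∀ i, y ⊗ₜ[R] z i = 0) :
    y ⊗ₜ[R] z = 0 := by
  classical
  rw [← DirectSum.sum_support_of z, TensorProduct.tmul_sum]
  refine Finset.sum_eq_zero fun i _ => ?_
  have := congrArg ((DirectSum.lof R ι N i).lTensor M) (h i)
  rwa [LinearMap.lTensor_tmul, map_zero] at this

end OrderIdeal

section ResidueHull

variable {R : Type u} [CommRing R]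

theorem tmul_residueHull_eq_zero_iff {M : Type*} [AddCommGroup M] [Module R M]
    [Module.FinitePresentation R M] {y : M} {z : ResidueHull R} :
    y ⊗ₜ[R] z = 0 ↔ z ∈ Submodule.torsionBySet R (ResidueHull R) (orderIdeal R y) := by
  refine ⟨mem_torsionBySet_orderIdeal_of_tmul_eq_zero,
    fun h => tmul_eq_zero_of_forall_directSum fun m => ?_⟩
  have := (InjectiveHull.isInjectiveHull R (R ⧸ m.asIdeal)).injective_module
  refine tmul_eq_zero_of_mem_torsionBySet_orderIdeal (mem_torsionBySet_orderIdeal.2 fun φ => ?_)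
  exact congrArg (DirectSum.component R _ _ m) (mem_torsionBySet_orderIdeal.1 h φ)

theorem exists_linearMap_residueHull_apply_ne_zero {M : Type*} [AddCommGroup M] [Module R M]
    {x : M} (hx : x ≠ 0) : ∃ f : M →ₗ[R] ResidueHull R, f x ≠ 0 := by
  classical
  obtain ⟨m, hm, hle⟩ := Ideal.exists_le_maximal (LinearMap.ker (LinearMap.toSpanSingleton R M x))
    fun h => hx (by simpa using (Ideal.eq_top_iff_one _).1 h)
  have hull := InjectiveHull.isInjectiveHull R (R ⧸ m)
  have := hull.injective_module
  obtain ⟨g, hg⟩ := exists_comp_eq_of_ker_le (LinearMap.toSpanSingleton R M x)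
    (InjectiveHull.ι R (R ⧸ m) ∘ₗ m.mkQ) (hle.trans fun r hr => by
      have : m.mkQ r = 0 := (Submodule.Quotient.mk_eq_zero m).2 hr
      rw [LinearMap.mem_ker, LinearMap.comp_apply, this, map_zero])
  have hgx : g x = InjectiveHull.ι R (R ⧸ m) (m.mkQ 1) := by
    simpa using LinearMap.congr_fun hg 1
  refine ⟨DirectSum.lof R _ (fun m : MaximalSpectrum R => InjectiveHull R (R ⧸ m.asIdeal))
    ⟨m, hm⟩ ∘ₗ g, fun h => hm.ne_top ((Ideal.eq_top_iff_one m).2 ?_)⟩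
  have h0 : InjectiveHull.ι R (R ⧸ m) (m.mkQ 1) = 0 :=
    hgx ▸ DirectSum.of_injective (β := fun m : MaximalSpectrum R =>
      InjectiveHull R (R ⧸ m.asIdeal)) ⟨m, hm⟩ (h.trans (map_zero _).symm)
  exact (Submodule.Quotient.mk_eq_zero m).1 (hull.injective_map (h0.trans (map_zero _).symm))

theorem annihilator_torsionBySet_residueHull_le (J : Ideal R) :
    (Submodule.torsionBySet R (ResidueHull R) J).annihilator ≤ J := by
  intro x hx
  by_contra hxJ
  obtain ⟨f, hf⟩ := exists_linearMap_residueHull_apply_ne_zero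
    (R := R) (x := Ideal.Quotient.mk J x) (mt Ideal.Quotient.eq_zero_iff_mem.1 hxJ)
  have hmk (r : R) : r • f 1 = f (Ideal.Quotient.mk J r) := by
    rw [← map_smul, Algebra.smul_def, mul_one]
    rfl
  refine hf ((hmk x).symm.trans (Submodule.mem_annihilator.1 hx _ ?_))
  refine (Submodule.mem_torsionBySet_iff _ _).2 fun r => ?_
  rw [hmk, Ideal.Quotient.eq_zero_iff_mem.2 r.2, map_zero]

end ResidueHull

section GenericProjectivity

variable {R : Type u} [CommRing R]

theorem exists_mem_ringCirc_of_forall_minimalPrimes [IsNoetherianRing R] {I : Ideal R}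
    (h : ∀ P ∈ minimalPrimes R, ¬ I ≤ P) : ∃ x ∈ I, x ∈ ringCirc R := by
  by_contra! hI
  have hsub : (I : Set R) ⊆ ⋃ P ∈ minimalPrimes R, P := fun x hx => by
    simpa [ringCirc, ← SetLike.mem_coe] using hI x hx
  obtain ⟨P, hP, hle⟩ := (Ideal.subset_union_prime_finite
    (minimalPrimes.finite_of_isNoetherianRing R) ⊥ ⊥ fun P hP _ _ => hP.1.1).1 hsub
  exact h P hP hle

theorem ringCirc_le_nonZeroDivisors [IsReduced R] : ringCirc R ≤ nonZeroDivisors R := by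
  intro c hc
  rw [mem_nonZeroDivisors_iff_right]
  intro x hx
  have hnil : x ∈ nilradical R := by
    rw [nilradical, ← Ideal.sInf_minimalPrimes, Submodule.mem_sInf]
    exact fun P hP => (hP.1.1.mem_or_mem (hx ▸ P.zero_mem)).resolve_right (hc P hP)
  exact (mem_nilradical.1 hnil).eq_zero

theorem isField_localization_of_mem_minimalPrimes [IsReduced R] {P : Ideal R} [P.IsPrime]
    (hP : P ∈ minimalPrimes R) : IsField (Localization.AtPrime P) := by
  rw [IsLocalRing.isField_iff_maximalIdeal_eq, ← Localization.AtPrime.map_eq_maximalIdeal,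
    ← IsLocalization.AtPrime.radical_map_of_mem_minimalPrimes (Localization.AtPrime P) P ⊥ hP,
    Ideal.map_bot]
  exact nilradical_eq_zero _

theorem exists_comp_eq_smul_id_of_projective_localizedModule (S : Submonoid R) {M N : Type*}
    [AddCommGroup M] [Module R M] [Module.FinitePresentation R M] [AddCommGroup N] [Module R N]
    [Module.Projective (Localization S) (LocalizedModule S M)]
    {π : N →ₗ[R] M} (hπ : Function.Surjective π) :
    ∃ s ∈ S, ∃ h : M →ₗ[R] N, π ∘ₗ h = s • LinearMap.id := by
  let fN := LocalizedModule.mkLinearMap S N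
  let fM := LocalizedModule.mkLinearMap S M
  obtain ⟨σ, hσ⟩ := Module.projective_lifting_property (LocalizedModule.map S π)
    LinearMap.id (LocalizedModule.map_surjective S π hπ)
  obtain ⟨h, s, hs⟩ := Module.FinitePresentation.exists_lift_of_isLocalizedModule S fN
    (σ.restrictScalars R ∘ₗ fM)
  have hπf : (LocalizedModule.map S π).restrictScalars R ∘ₗ fN = fM ∘ₗ π := by
    ext x
    simp [fN, fM, LocalizedModule.mkLinearMap_apply, LocalizedModule.map_mk]
  have hlocal : fM ∘ₗ (π ∘ₗ h) = fM ∘ₗ (s • LinearMap.id) := by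
    rw [← LinearMap.comp_assoc, ← hπf, LinearMap.comp_assoc, hs]
    ext x
    have := LinearMap.congr_fun hσ (fM x)
    simp only [LinearMap.comp_apply, LinearMap.smul_apply, LinearMap.restrictScalars_apply,
      LinearMap.id_apply, Submonoid.smul_def, map_smul] at this ⊢
    rw [this]
  obtain ⟨s', hs'⟩ :=
    Module.Finite.exists_smul_of_comp_eq_of_isLocalizedModule S fM _ _ hlocal
  exact ⟨s' * s, (s' * s).2, (s' : R) • h, by rw [LinearMap.comp_smul, mul_smul]; exact hs'⟩

theorem exists_mem_ringCirc_comp_eq_smul_id [IsNoetherianRing R] [IsReduced R] {M N : Type*}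
    [AddCommGroup M] [Module R M] [Module.Finite R M] [AddCommGroup N] [Module R N]
    {π : N →ₗ[R] M} (hπ : Function.Surjective π) :
    ∃ d ∈ ringCirc R, ∃ h : M →ₗ[R] N, π ∘ₗ h = d • LinearMap.id := by
  have := Module.finitePresentation_of_finite R M
  let T : Ideal R := (LinearMap.range (π.compRight R : (M →ₗ[R] N) →ₗ[R] M →ₗ[R] M)).comap
    (LinearMap.toSpanSingleton R (M →ₗ[R] M) LinearMap.id)
  obtain ⟨d, ⟨h, hh⟩, hd⟩ := exists_mem_ringCirc_of_forall_minimalPrimes (I := T)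
    fun P hP hle => by
      have : P.IsPrime := hP.1.1
      let := (isField_localization_of_mem_minimalPrimes hP).toField
      have : Module.Projective (Localization.AtPrime P) (LocalizedModule P.primeCompl M) :=
        inferInstance
      obtain ⟨s, hs, h, hh⟩ :=
        exists_comp_eq_smul_id_of_projective_localizedModule P.primeCompl hπ
      exact hs (hle ⟨h, hh⟩)
  exact ⟨d, hd, h, hh⟩

theorem exists_mem_ringCirc_smul_mem_orderIdeal_smul_top [IsNoetherianRing R] [IsReduced R]
    (M : Type*) [AddCommGroup M] [Module R M] [Module.Finite R M] :
    ∃ d ∈ ringCirc R, ∀ x : M, d • x ∈ orderIdeal R x • (⊤ : Submodule R M) := by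
  obtain ⟨n, π, hπ⟩ := Module.Finite.exists_fin' R M
  obtain ⟨d, hd, h, hh⟩ := exists_mem_ringCirc_comp_eq_smul_id hπ
  refine ⟨d, hd, fun x => ?_⟩
  have hx : π (h x) = d • x := LinearMap.congr_fun hh x
  rw [← hx, π.pi_apply_eq_sum_univ]
  exact Submodule.sum_mem _ fun i _ =>
    Submodule.smul_mem_smul ⟨LinearMap.proj i ∘ₗ h, rfl⟩ Submodule.mem_top

end GenericProjectivity

section CartierIdeal

variable {R : Type u} [CommRing R] {p : ℕ} [Fact p.Prime] [CharP R p] {e : ℕ}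

/-- The ideal of all values at `x` of `p⁻ᵉ`-linear maps on `R`, which are encoded as linear forms on
`ᵉR`. -/
def cartierIdeal (p e : ℕ) [Fact p.Prime] [CharP R p] (x : R) : Ideal R :=
  orderIdeal R (toFrobTwist R p e x)

theorem mem_cartierIdeal {x y : R} :
    y ∈ cartierIdeal p e x ↔ ∃ ψ : R →+ R, (∀ r s, ψ (r ^ p ^ e * s) = r * ψ s) ∧ ψ x = y := by
  constructor
  · rintro ⟨φ, rfl⟩
    exact ⟨φ.toAddMonoidHom.comp (toFrobTwist R p e).toAddMonoidHom, fun r s => φ.map_smul r s, rfl⟩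
  · rintro ⟨ψ, hψ, rfl⟩
    exact ⟨{ toFun := fun s => ψ ((toFrobTwist R p e).symm s)
             map_add' := fun s s' => ψ.map_add s s'
             map_smul' := hψ }, rfl⟩

theorem self_mem_cartierIdeal_zero (x : R) : x ∈ cartierIdeal p 0 x :=
  mem_cartierIdeal.2 ⟨AddMonoidHom.id R, by simp, rfl⟩

theorem cartierIdeal_le_of_mem {e' : ℕ} {x y : R} (h : y ∈ cartierIdeal p e' x) :
    cartierIdeal p e y ≤ cartierIdeal p (e + e') x := by
  obtain ⟨φ, hφ, rfl⟩ := mem_cartierIdeal.1 h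
  intro z hz
  obtain ⟨ψ, hψ, rfl⟩ := mem_cartierIdeal.1 hz
  exact mem_cartierIdeal.2 ⟨ψ.comp φ, fun r s => by
    rw [AddMonoidHom.comp_apply, pow_add, pow_mul, hφ, hψ, AddMonoidHom.comp_apply], rfl⟩

theorem cartierIdeal_le_of_dvd {x y : R} (h : x ∣ y) : cartierIdeal p e y ≤ cartierIdeal p e x := by
  obtain ⟨a, rfl⟩ := h
  rintro _ ⟨φ, rfl⟩
  exact ⟨φ ∘ₗ LinearMap.mulRight R (toFrobTwist R p e a), rfl⟩

theorem mul_mem_cartierIdeal_pow_mul {x y : R} (r : R) (h : y ∈ cartierIdeal p e x) :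
    r * y ∈ cartierIdeal p e (r ^ p ^ e * x) := by
  obtain ⟨ψ, hψ, rfl⟩ := mem_cartierIdeal.1 h
  exact mem_cartierIdeal.2 ⟨ψ, hψ, hψ r x⟩

theorem cartierIdeal_add_le (x y : R) :
    cartierIdeal p e (x + y) ≤ cartierIdeal p e x ⊔ cartierIdeal p e y := by
  rintro _ ⟨φ, rfl⟩
  exact (φ.map_add _ _).symm ▸ Submodule.add_mem_sup ⟨φ, rfl⟩ ⟨φ, rfl⟩

theorem IsFFinite.finite_frobTwist (hF : IsFFinite R p) (e : ℕ) :
    Module.Finite R (FrobTwist R p e) := by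
  have hfrob : (iterateFrobenius R p e).Finite := by
    induction e with
    | zero => exact iterateFrobenius_zero R p ▸ RingHom.Finite.id R
    | succ e ih =>
      rw [iterateFrobenius_add, iterateFrobenius_one]
      exact ih.comp hF
  exact (RingHom.Finite.of_surjective _ (toFrobTwist R p e).surjective).comp hfrob

end CartierIdeal

section TestElements

variable {R : Type u} [CommRing R] {p : ℕ} [Fact p.Prime] [CharP R p] {d : R}

/-- Every `d * x` is an `R`-linear combination of elements `ψ x ^ p` with `ψ` a `p⁻¹`-linear map. If
`R` is F-finite and Noetherian, this makes `F_*R` projective after inverting `d`. -/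
def IsFrobeniusProjectiveAway (p : ℕ) [Fact p.Prime] [CharP R p] (d : R) : Prop :=
  ∀ x, d * x ∈ (cartierIdeal p 1 x).map (frobenius R p)

theorem IsFFinite.exists_isFrobeniusProjectiveAway [IsNoetherianRing R] [IsReduced R]
    (hF : IsFFinite R p) : ∃ d ∈ ringCirc R, IsFrobeniusProjectiveAway p d := by
  have := hF.finite_frobTwist 1
  obtain ⟨d, hd, h⟩ := exists_mem_ringCirc_smul_mem_orderIdeal_smul_top (R := R) (FrobTwist R p 1)
  refine ⟨d ^ p, pow_mem hd p, fun x => ?_⟩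
  have hx : toFrobTwist R p 1 (d ^ p ^ 1 * x) ∈
      (cartierIdeal p 1 x).map (algebraMap R (FrobTwist R p 1)) := by
    have := h (toFrobTwist R p 1 x)
    rw [Ideal.smul_top_eq_map] at this
    exact this
  rw [pow_one] at hx
  rw [← iterateFrobenius_one]
  exact hx

namespace IsFrobeniusProjectiveAway

theorem mem_cartierIdeal_one (hd : IsFrobeniusProjectiveAway p d) : d ∈ cartierIdeal p 1 1 := by
  refine Ideal.map_le_iff_le_comap.2 (fun x hx => ?_) (mul_one d ▸ hd 1)
  exact Ideal.pow_mem_of_mem _ hx p (Fact.out : p.Prime).pos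

theorem mul_mem_cartierIdeal_succ (hd : IsFrobeniusProjectiveAway p d) {e : ℕ} {x y : R}
    (hy : y ∈ cartierIdeal p e x) : d * y ∈ cartierIdeal p (e + 1) x := by
  have hy' : y * d ∈ cartierIdeal p 1 (y ^ p ^ 1 * 1) :=
    mul_mem_cartierIdeal_pow_mul y hd.mem_cartierIdeal_one
  rw [mul_comm d, add_comm e]
  refine cartierIdeal_le_of_mem hy (cartierIdeal_le_of_dvd ?_ hy')
  exact (dvd_pow_self y (pow_pos (Fact.out : p.Prime).pos 1).ne').mul_right 1

theorem pow_mul_mem_cartierIdeal_add (hd : IsFrobeniusProjectiveAway p d) {e : ℕ} {x y : R}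
    (hy : y ∈ cartierIdeal p e x) (k : ℕ) : d ^ k * y ∈ cartierIdeal p (e + k) x := by
  induction k with
  | zero => simpa using hy
  | succ k ih =>
    rw [pow_succ', mul_assoc]
    exact hd.mul_mem_cartierIdeal_succ ih

theorem sq_mem_cartierIdeal_one (hd : IsFrobeniusProjectiveAway p d) (e : ℕ) :
    d ^ 2 ∈ cartierIdeal p e 1 := by
  induction e with
  | zero => exact Ideal.mem_of_dvd _ (one_dvd _) (self_mem_cartierIdeal_zero 1)
  | succ e ih =>
    have hsq : d * d ∈ cartierIdeal p 1 (d ^ p ^ 1 * 1) :=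
      mul_mem_cartierIdeal_pow_mul d hd.mem_cartierIdeal_one
    rw [← sq, pow_one] at hsq
    rw [add_comm e]
    exact cartierIdeal_le_of_mem ih (cartierIdeal_le_of_dvd
      ((pow_dvd_pow d (Fact.out : p.Prime).two_le).mul_right 1) hsq)

theorem exists_pow_mul_mem_map_iterateFrobenius (hd : IsFrobeniusProjectiveAway p d) (e : ℕ) :
    ∃ k, ∀ x, d ^ k * x ∈ (cartierIdeal p e x).map (iterateFrobenius R p e) := by
  induction e with
  | zero => exact ⟨0, fun x => by
      simpa [iterateFrobenius_zero] using self_mem_cartierIdeal_zero (p := p) x⟩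
  | succ e ih =>
    obtain ⟨k, hk⟩ := ih
    refine ⟨k * p + 1, fun x => ?_⟩
    have hle : Ideal.span {d ^ k} * cartierIdeal p 1 x ≤
        (cartierIdeal p (e + 1) x).map (iterateFrobenius R p e) := by
      refine Ideal.span_singleton_mul_le_iff.2 fun y hy => ?_
      exact Ideal.map_mono (cartierIdeal_le_of_mem hy) (hk y)
    have hmap := Ideal.map_mono (f := frobenius R p) hle
    rw [Ideal.map_mul, Ideal.map_span, Set.image_singleton, Ideal.map_map, frobenius_def,
      ← pow_mul, ← iterateFrobenius_one, ← iterateFrobenius_add, add_comm 1 e,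
      iterateFrobenius_one] at hmap
    rw [pow_succ, mul_assoc]
    exact hmap (Ideal.mul_mem_mul (Ideal.mem_span_singleton_self _) (hd x))

theorem exists_pow_mul_mem_cartierIdeal_of_mem_iSup (hd : IsFrobeniusProjectiveAway p d) {c x : R}
    (hx : x ∈ ⨆ e, cartierIdeal p e c) : ∃ e m, d ^ m * x ∈ cartierIdeal p e c := by
  induction hx using Submodule.iSup_induction' with
  | mem e x hx => exact ⟨e, 0, by simpa using hx⟩
  | zero => exact ⟨0, 0, by simp⟩
  | add x y _ _ hx hy =>
    obtain ⟨e, m, hx⟩ := hx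
    obtain ⟨e', m', hy⟩ := hy
    have hx' := hd.pow_mul_mem_cartierIdeal_add hx e'
    have hy' := hd.pow_mul_mem_cartierIdeal_add hy e
    rw [add_comm e' e] at hy'
    refine ⟨e + e', m + m' + (e + e'), ?_⟩
    convert add_mem (Ideal.mul_mem_left _ (d ^ (m' + e)) hx')
      (Ideal.mul_mem_left _ (d ^ (m + e')) hy') using 1
    ring

theorem exists_pow_mem_iSup_cartierIdeal [IsNoetherianRing R] (hd : IsFrobeniusProjectiveAway p d)
    {c : R} (hc : c ∈ nonZeroDivisors R) : ∃ m, d ^ m ∈ ⨆ e, cartierIdeal p e c := by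
  by_contra! hdisj
  obtain ⟨P, hP, hle, hPd⟩ := Ideal.exists_le_prime_disjoint (⨆ e, cartierIdeal p e c)
    (Submonoid.powers d) (Set.disjoint_right.2 (by rintro _ ⟨m, rfl⟩; exact hdisj m))
  have hdP : d ∈ P.primeCompl := fun h => Set.disjoint_left.1 hPd h (Submonoid.mem_powers d)
  let A := Localization.AtPrime P
  have hc_mem (k : ℕ) : algebraMap R A c ∈ IsLocalRing.maximalIdeal A ^ k := by
    obtain ⟨l, hl⟩ := hd.exists_pow_mul_mem_map_iterateFrobenius k
    have hPk : d ^ l * c ∈ P ^ k := by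
      refine Ideal.map_le_iff_le_comap.2 (fun x hx => ?_) (hl c)
      exact Ideal.pow_le_pow_right (Nat.lt_pow_self (Fact.out : p.Prime).one_lt).le
        (Ideal.pow_mem_pow (hle (Ideal.mem_iSup_of_mem k hx)) _)
    have hmap := Ideal.mem_map_of_mem (algebraMap R A) hPk
    rw [Ideal.map_pow, Localization.AtPrime.map_eq_maximalIdeal, map_mul] at hmap
    exact (Ideal.unit_mul_mem_iff_mem _
      (IsLocalization.map_units A (⟨d ^ l, pow_mem hdP l⟩ : P.primeCompl))).1 hmap
  have hc_zero : algebraMap R A c = 0 := by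
    have : algebraMap R A c ∈ ⨅ k, IsLocalRing.maximalIdeal A ^ k := Ideal.mem_iInf.2 hc_mem
    rwa [Ideal.iInf_pow_eq_bot_of_isLocalRing _ Ideal.IsPrime.ne_top'] at this
  obtain ⟨s, hs⟩ := (IsLocalization.map_eq_zero_iff P.primeCompl A c).1 hc_zero
  exact s.2 ((mem_nonZeroDivisors_iff_right.1 hc s hs).symm ▸ P.zero_mem)

theorem exists_pow_mem_cartierIdeal [IsNoetherianRing R] (hd : IsFrobeniusProjectiveAway p d)
    {c : R} (hc : c ∈ nonZeroDivisors R) : ∃ e m, d ^ m ∈ cartierIdeal p e c := by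
  obtain ⟨m, hm⟩ := hd.exists_pow_mem_iSup_cartierIdeal hc
  obtain ⟨e, m', h⟩ := hd.exists_pow_mul_mem_cartierIdeal_of_mem_iSup hm
  exact ⟨e, m' + m, pow_add d m' m ▸ h⟩

end IsFrobeniusProjectiveAway

/-- An element of `R°` that lies in the image of `c` under `p⁻ᵉ`-linear maps, for every `c ∈ R°` and
arbitrarily large `e`: a test element for all the tight closures `0_E^{*𝔞₁ ^ t₁ ⋯ 𝔞ᵣ ^ tᵣ}`. -/
structure IsCartierTestElement (p : ℕ) [Fact p.Prime] [CharP R p] (D : R) : Prop where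
  mem_ringCirc : D ∈ ringCirc R
  exists_mem_cartierIdeal : ∀ c ∈ ringCirc R, ∀ e₀ : ℕ, ∃ e ≥ e₀, D ∈ cartierIdeal p e c

theorem IsFrobeniusProjectiveAway.isCartierTestElement_pow_three [IsNoetherianRing R] [IsReduced R]
    (hd : IsFrobeniusProjectiveAway p d) (hdR : d ∈ ringCirc R) :
    IsCartierTestElement p (d ^ 3) where
  mem_ringCirc := pow_mem hdR 3
  exists_mem_cartierIdeal c hc e₀ := by
    obtain ⟨e, m, hm⟩ := hd.exists_pow_mem_cartierIdeal (ringCirc_le_nonZeroDivisors hc)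
    have hmul : d * d ^ 2 ∈ cartierIdeal p (m + e₀) (d ^ p ^ (m + e₀) * 1) :=
      mul_mem_cartierIdeal_pow_mul d (hd.sq_mem_cartierIdeal_one (m + e₀))
    have hle : m ≤ p ^ (m + e₀) :=
      (Nat.le_add_right m e₀).trans (Nat.lt_pow_self (Fact.out : p.Prime).one_lt).le
    refine ⟨m + e₀ + e, by omega, cartierIdeal_le_of_mem hm ?_⟩
    rw [pow_succ']
    exact cartierIdeal_le_of_dvd ((pow_dvd_pow d hle).mul_right 1) hmul

end TestElements

section CeilPow

theorem exists_sum_eq_and_forall_ceil_mul_le {ι : Type*} [Fintype ι] {t q : ℝ} (ht : 0 ≤ t)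
    (hq : 0 < q) {k : ι → ℕ} (hk : ∑ i, k i = ⌈t * q⌉₊) :
    ∃ v : ι → ℝ, 0 ≤ v ∧ ∑ i, v i = t ∧ ∀ i, ⌈v i * q⌉₊ ≤ k i := by
  refine ⟨fun i => t * (k i / ⌈t * q⌉₊), fun i => by positivity, ?_, fun i => Nat.ceil_le.2 ?_⟩
  · rw [← Finset.mul_sum, ← Finset.sum_div, ← Nat.cast_sum, hk]
    rcases ht.eq_or_lt with rfl | ht
    · exact zero_mul _
    · rw [div_self (Nat.cast_ne_zero.2 (Nat.ceil_pos.2 (mul_pos ht hq)).ne'), mul_one]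
  · calc t * (k i / ⌈t * q⌉₊) * q = k i * (t * q / ⌈t * q⌉₊) := by ring
      _ ≤ k i := mul_le_of_le_one_right (Nat.cast_nonneg _)
        (div_le_one_of_le₀ (Nat.le_ceil _) (Nat.cast_nonneg _))

theorem nat_ceil_sum_le {ι : Type*} (s : Finset ι) (f : ι → ℝ) :
    ⌈∑ i ∈ s, f i⌉₊ ≤ ∑ i ∈ s, ⌈f i⌉₊ := by
  rw [Nat.ceil_le, Nat.cast_sum]
  exact Finset.sum_le_sum fun i _ => Nat.le_ceil (f i)

variable {R : Type u} [CommRing R] {p : ℕ} {r : ℕ}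

theorem pow_mem_ceilPow {𝔞 : Fin r → Ideal R} {t : Fin r → ℝ} {e : ℕ} {y : R}
    (hy : y ∈ ceilPow p 𝔞 t e) (e' : ℕ) :
    y ^ p ^ e' ∈ ceilPow p 𝔞 t (e + e') := by
  have hle : ceilPow p 𝔞 t e ^ p ^ e' ≤ ceilPow p 𝔞 t (e + e') := by
    rw [ceilPow, ceilPow, ← Finset.prod_pow]
    refine Finset.prod_le_prod' fun i _ => ?_
    rw [← pow_mul]
    refine Ideal.pow_le_pow_right (Nat.ceil_le.2 ?_)
    push_cast
    rw [pow_add, ← mul_assoc]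
    exact mul_le_mul_of_nonneg_right (Nat.le_ceil _) (by positivity)
  exact hle (Ideal.pow_mem_pow hy _)

theorem ceilPow_singleton (𝔟 : Ideal R) (t : ℝ) (e : ℕ) :
    ceilPow p ![𝔟] ![t] e = 𝔟 ^ ⌈t * (p : ℝ) ^ e⌉₊ := by
  simp only [ceilPow, Fin.prod_univ_one, Matrix.cons_val_zero]

theorem ceilPow_sum (hp : 0 < p) (𝔞 : Fin r → Ideal R) {t : ℝ} (ht : 0 ≤ t) (e : ℕ) :
    ceilPow p ![∑ i, 𝔞 i] ![t] e =
      ⨆ (v : Fin r → ℝ) (_ : 0 ≤ v) (_ : ∑ i, v i = t), ceilPow p 𝔞 v e := by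
  rw [ceilPow_singleton]
  apply le_antisymm
  · rw [Finset.sum_pow_eq_sum_piAntidiag, Ideal.sum_eq_sup]
    refine Finset.sup_le fun k hk => Ideal.mul_le_right.trans ?_
    obtain ⟨v, hv, hsum, hceil⟩ := exists_sum_eq_and_forall_ceil_mul_le ht
      (pow_pos (Nat.cast_pos.2 hp) e) (Finset.mem_piAntidiag.1 hk).1
    refine le_iSup_of_le v (le_iSup₂_of_le hv hsum ?_)
    exact Finset.prod_le_prod' fun i _ => Ideal.pow_le_pow_right (hceil i)
  · refine iSup_le fun v => iSup₂_le fun _ hsum => ?_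
    calc ceilPow p 𝔞 v e ≤ ∏ i, (∑ j, 𝔞 j) ^ ⌈v i * (p : ℝ) ^ e⌉₊ :=
          Finset.prod_le_prod' fun i hi => Ideal.pow_right_mono
            (Ideal.sum_eq_sup (s := Finset.univ) 𝔞 ▸ Finset.le_sup hi) _
      _ = (∑ j, 𝔞 j) ^ ∑ i, ⌈v i * (p : ℝ) ^ e⌉₊ := Finset.prod_pow_eq_pow_sum _ _ _
      _ ≤ (∑ j, 𝔞 j) ^ ⌈t * (p : ℝ) ^ e⌉₊ := by
        rw [← hsum, Finset.sum_mul]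
        exact Ideal.pow_le_pow_right (nat_ceil_sum_le _ _)

end CeilPow

section TauTilde

variable {R : Type u} [CommRing R] {p : ℕ} [Fact p.Prime] [CharP R p] {e r : ℕ}
  {𝔞 : Fin r → Ideal R} {t : Fin r → ℝ}

/-- The ideal generated by the images of an ideal `𝔟` under all `p⁻ᵉ`-linear maps on `R`. For
regular `R` it is the ideal `𝔟^[1/q]`, where `q = p ^ e`. -/
def cartierImage (p e : ℕ) [Fact p.Prime] [CharP R p] (𝔟 : Ideal R) : Ideal R :=
  ⨆ x ∈ 𝔟, cartierIdeal p e x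

theorem cartierImage_iSup {ι : Sort*} (𝔟 : ι → Ideal R) :
    cartierImage p e (⨆ i, 𝔟 i) = ⨆ i, cartierImage p e (𝔟 i) := by
  refine le_antisymm (iSup₂_le fun x hx => ?_)
    (iSup_le fun i => biSup_mono fun x hx => le_iSup 𝔟 i hx)
  induction hx using Submodule.iSup_induction' with
  | mem i x hx => exact (le_iSup₂_of_le x hx le_rfl).trans (le_iSup (cartierImage p e <| 𝔟 ·) i)
  | zero =>
    rintro _ ⟨φ, rfl⟩
    exact (φ.map_zero).symm ▸ zero_mem _
  | add x y _ _ hx hy => exact (cartierIdeal_add_le x y).trans (sup_le hx hy)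

theorem frobImage_bot {M : Type u} [AddCommGroup M] [Module R M] :
    frobImage p e (⊥ : Submodule R M) = ⊥ := by
  rw [frobImage, LinearMap.range_eq_bot, Subsingleton.elim (⊥ : Submodule R M).subtype 0,
    LinearMap.baseChange_zero]

theorem smul_frobPow {M : Type u} [AddCommGroup M] [Module R M] (x : R) (z : M) :
    toFrobTwist R p e x • frobPow p e z = toFrobTwist R p e x ⊗ₜ[R] z := by
  rw [frobPow, TensorProduct.smul_tmul', smul_eq_mul, mul_one]

theorem mem_tightClosure_bot_residueHull [IsNoetherianRing R] (hF : IsFFinite R p)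
    {z : ResidueHull R} :
    z ∈ tightClosure p 𝔞 t (⊥ : Submodule R (ResidueHull R)) ↔
      ∃ c ∈ ringCirc R, ∃ e₀ : ℕ, ∀ e ≥ e₀, ∀ x ∈ ceilPow p 𝔞 t e,
        z ∈ Submodule.torsionBySet R (ResidueHull R) (cartierIdeal p e (c * x)) := by
  change (∃ c ∈ ringCirc R, ∃ e₀ : ℕ, ∀ e ≥ e₀, ∀ x ∈ ceilPow p 𝔞 t e,
    toFrobTwist R p e (c * x) • frobPow p e z ∈ frobImage p e ⊥) ↔ _
  have (e : ℕ) : Module.FinitePresentation R (FrobTwist R p e) :=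
    have := hF.finite_frobTwist e
    Module.finitePresentation_of_finite R _
  simp only [frobImage_bot, smul_frobPow, Submodule.mem_bot, tmul_residueHull_eq_zero_iff,
    cartierIdeal]

namespace IsCartierTestElement

variable {D : R}

theorem cartierIdeal_mul_le_tauTilde [IsNoetherianRing R] (hD : IsCartierTestElement p D)
    (hF : IsFFinite R p) {y : R} (hy : y ∈ ceilPow p 𝔞 t e) :
    cartierIdeal p e (D * y) ≤ tauTilde p 𝔞 t := by
  refine fun u hu => Submodule.mem_annihilator.2 fun z hz => ?_
  obtain ⟨c, hc, e₀, hz⟩ := (mem_tightClosure_bot_residueHull hF).1 hz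
  obtain ⟨e', he', hDc⟩ := hD.exists_mem_cartierIdeal c hc e₀
  have hu' : u ∈ cartierIdeal p (e + e') (c * y ^ p ^ e') := by
    rw [mul_comm] at hu ⊢
    exact cartierIdeal_le_of_mem (mul_mem_cartierIdeal_pow_mul y hDc) hu
  exact (Submodule.mem_torsionBySet_iff _ _).1
    (hz (e + e') (he'.trans (Nat.le_add_left e' e)) _ (pow_mem_ceilPow hy e')) ⟨u, hu'⟩

theorem tauTilde_eq_iSup_cartierImage [IsNoetherianRing R] (hD : IsCartierTestElement p D)
    (hF : IsFFinite R p) (𝔞 : Fin r → Ideal R) (t : Fin r → ℝ) :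
    tauTilde p 𝔞 t = ⨆ e, cartierImage p e (Ideal.span {D} * ceilPow p 𝔞 t e) := by
  apply le_antisymm
  · refine (Submodule.annihilator_mono fun z hz => ?_).trans
      (annihilator_torsionBySet_residueHull_le _)
    refine (mem_tightClosure_bot_residueHull hF).2 ⟨D, hD.mem_ringCirc, 0, fun e _ y hy => ?_⟩
    have hDy : D * y ∈ Ideal.span {D} * ceilPow p 𝔞 t e :=
      Ideal.mul_mem_mul (Ideal.mem_span_singleton_self D) hy
    have hle : cartierIdeal p e (D * y) ≤
        ⨆ e, cartierImage p e (Ideal.span {D} * ceilPow p 𝔞 t e) :=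
      le_iSup_of_le e (le_iSup₂_of_le (D * y) hDy le_rfl)
    exact Submodule.torsionBySet_le_torsionBySet_of_subset hle hz
  · refine iSup_le fun e => iSup₂_le fun x hx => ?_
    obtain ⟨y, hy, rfl⟩ := Ideal.mem_span_singleton_mul.1 hx
    exact hD.cartierIdeal_mul_le_tauTilde hF hy

end IsCartierTestElement

end TauTilde

theorem theorem3p1_general {R : Type u} [CommRing R] [IsNoetherianRing R] [IsReduced R]
    (p : ℕ) [Fact p.Prime] [CharP R p] (hF : IsFFinite R p) {r : ℕ} (𝔞 : Fin r → Ideal R)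
    {t : ℝ} (ht : 0 ≤ t) :
    tauTilde p ![∑ i, 𝔞 i] ![t] =
      ⨆ (v : Fin r → ℝ) (_ : 0 ≤ v) (_ : ∑ i, v i = t), tauTilde p 𝔞 v := by
  obtain ⟨d, hd, hproj⟩ := hF.exists_isFrobeniusProjectiveAway
  have hD := hproj.isCartierTestElement_pow_three hd
  simp only [hD.tauTilde_eq_iSup_cartierImage hF, ceilPow_sum (Fact.out : p.Prime).pos 𝔞 ht,
    Ideal.mul_iSup, cartierImage_iSup, iSup_comm (ι := ℕ)]

theorem theorem3p1 {R : Type u} [CommRing R] [IsNoetherianRing R] [IsReduced R]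
    (p : ℕ) [Fact p.Prime] [CharP R p] (hF : IsFFinite R p)
    (𝔞 𝔟 : Ideal R) (h𝔞 : ∃ c ∈ 𝔞, c ∈ ringCirc R) (h𝔟 : ∃ c ∈ 𝔟, c ∈ ringCirc R)
    (t : ℝ) (ht : 0 < t) :
    tauTilde p ![𝔞 + 𝔟] ![t] =
      ⨆ (lam : ℝ) (mu : ℝ) (_ : 0 ≤ lam) (_ : 0 ≤ mu) (_ : lam + mu = t),
        tauTilde p ![𝔞, 𝔟] ![lam, mu] := by
  have := theorem3p1_general p hF ![𝔞, 𝔟] ht.le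
  rw [Fin.sum_univ_two, ← (finTwoArrowEquiv ℝ).symm.iSup_comp, iSup_prod] at this
  simpa [Pi.le_def, Fin.forall_fin_two, iSup_and] using this
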